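/- Let $\mathcal H$ be a complex Hilbert space, $B$ a bounded selfadjoint operator on $\mathcal H$ and $\mathcal S$ a closed subspace of $\mathcal H$. Suppose that $\mathcal S=\mathcal S_+\oplus_B\mathcal S_-$ is any decomposition of $\mathcal S$ as the orthogonal direct sum of closed subspaces $\mathcal S_+,\mathcal S_-$ such that $\langle Bs,t\rangle=0$ for all $s\in\mathcal S_+$, $t\in\mathcal S_-$, $\langle Bs,s\rangle\ge 0$ for all $s\in\mathcal S_+$ and $\langle Bs,s\rangle\le 0$ for all $s\in\mathcal S_-$. Notation. $R(\cdot)$ and $N(\cdot)$ denote range and nullspace, $|T|=(T^*T)^{1/2}$, and $X\le Y$ means that $Y-X$ is positive semidefinite. Write $$B=\begin{bmatrix} a & b\\ b^* & c\end{bmatrix}\quad\text{with respect to } \mathcal H=\mathcal S\oplus\mathcal S^\perp .$$ $B$ is called $\mathcal S$-weakly complementable if $R(b)\subseteq R(|a|^{1/2})$. In that case let $f:\mathcal S^\perp\to\mathcal S$ be the reduced solution of $b=|a|^{1/2}x$, i.e. the unique bounded operator with $b=|a|^{1/2}f$, $N(f)=N(b)$ and $R(f)\subseteq\overline{R(|a|^{1/2})}$,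 let $a=u|a|$ be the polar decomposition of $a$, with $u$ the partial isometry such that $N(u)=N(a)$, and define the Schur complement of $B$ to $\mathcal S$ by $$B_{/\mathcal S}=\begin{bmatrix}0&0\\0&c-f^*uf\end{bmatrix}.$$ For a bounded selfadjoint operator $C$ on $\mathcal H$ and a closed subspace $\mathcal T$ put $$\mathcal M^-(C,\mathcal T^\perp)=\{X=X^*\in L(\mathcal H): X\le C,\ R(X)\subseteq\mathcal T^\perp\},\qquad \mathcal M^+(C,\mathcal T^\perp)=\{X=X^*\in L(\mathcal H): C\le X,\ R(X)\subseteq\mathcal T^\perp\},$$ and let $\max$ and $\min$ denote the greatest and the least element of a set of operators for the order $\le$, when it exists. An iterated expression such as $\min\mathcal M^+(\max\mathcal M^-(B,\mathcal S_+^\perp),\mathcal S_-^\perp)$ is said to exist if the inner maximum exists and then the outer minimum exists; similarly with the roles exchanged. Theorem. $B$ is $\mathcal S$-weakly complementable if and only if both $$\min\mathcal M^+\bigl(\max\mathcal M^-(B,\mathcal S_+^\perp),\mathcal S_-^\perp\bigr)\quad\text{and}\quad \max\mathcal M^-\bigl(\min\mathcal M^+(B,\mathcal S_-^\perp),\mathcal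 S_+^\perp\bigr)$$ exist. In this case, $$B_{/\mathcal S}=\min\mathcal M^+\bigl(\max\mathcal M^-(B,\mathcal S_+^\perp),\mathcal S_-^\perp\bigr)=\max\mathcal M^-\bigl(\min\mathcal M^+(B,\mathcal S_-^\perp),\mathcal S_+^\perp\bigr).$$ -/

import Mathlib

open ContinuousLinearMap

namespace SchurMinMax

/-- Two vectors in the orthogonal complement of `N(Y)` with the same image are equal. -/
theorem eq_of_mem_orthogonal_ker {F G : Type*}
    [NormedAddCommGroup F] [InnerProductSpace ℂ F]
    [NormedAddCommGroup G] [InnerProductSpace ℂ G] {Y : F →L[ℂ] G} {v w : F}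
    (hv : v ∈ Y.kerᗮ) (hw : w ∈ Y.kerᗮ)
    (h : Y v = Y w) : v = w := by
  have h1 : v - w ∈ Y.ker := by simp [h]
  have h2 : v - w ∈ Y.kerᗮ := Submodule.sub_mem _ hv hw
  have h3 := Submodule.inner_right_of_mem_orthogonal h1 h2
  exact sub_eq_zero.mp (inner_self_eq_zero.mp h3)

section Factorization

variable {E F G : Type*}
  [NormedAddCommGroup E] [InnerProductSpace ℂ E] [CompleteSpace E]
  [NormedAddCommGroup F] [InnerProductSpace ℂ F] [CompleteSpace F]
  [NormedAddCommGroup G] [InnerProductSpace ℂ G] [CompleteSpace G]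

/-- `D` is the reduced solution of the operator equation `Z = Y X`: it is a solution,
`N(D) = N(Z)`, and `R(D)` lies in the closure of `R(Y*)`. -/
structure IsReducedSolution (Y : F →L[ℂ] G) (Z : E →L[ℂ] G) (D : E →L[ℂ] F) : Prop where
  comp_eq : Y ∘L D = Z
  ker_eq : D.ker = Z.ker
  range_le : D.range ≤ (adjoint Y).range.topologicalClosure

/-- A bounded operator is a partial isometry if it is isometric on the orthogonal complement
of its nullspace. -/
def IsPartialIsometry (U : E →L[ℂ] F) : Prop :=
  ∀ x ∈ U.kerᗮ, ‖U x‖ = ‖x‖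

/-- `|T|^(1/2)`, where `|T| = (T* T)^(1/2)`. -/
noncomputable def modulusSqrt (T : E →L[ℂ] E) : E →L[ℂ] E := CFC.sqrt (CFC.abs T)

/-- `U` is the partial isometry of the polar decomposition `T = U |T|`, where
`|T| = (T* T)^(1/2)` and `N(U) = N(T)`. -/
structure IsPolarFactor (T U : E →L[ℂ] E) : Prop where
  isPartialIsometry : IsPartialIsometry U
  ker_eq : U.ker = T.ker
  comp_abs : U ∘L CFC.abs T = T

/-- Douglas' lemma: a range inclusion yields a unique reduced solution. -/
theorem existsUnique_isReducedSolution (Y : F →L[ℂ] G) (Z : E →L[ℂ] G)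
    (h : Z.range ≤ Y.range) : ∃! D : E →L[ℂ] F, IsReducedSolution Y Z D := by
  have hex : ∀ x : E, ∃ y : F, y ∈ Y.kerᗮ ∧ Y y = Z x := by
    intro x
    obtain ⟨y, hy⟩ := h (LinearMap.mem_range_self _ x)
    have hy' : Y y = Z x := hy
    refine ⟨y - Y.ker.starProjection y, Submodule.sub_starProjection_mem_orthogonal y, ?_⟩
    have : Y (Y.ker.starProjection y) = 0 := Submodule.starProjection_apply_mem Y.ker y
    rw [map_sub, this, sub_zero, hy']
  choose g hg hYg using hex
  let gl : E →ₗ[ℂ] F :=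
    { toFun := g
      map_add' := fun x y => eq_of_mem_orthogonal_ker (hg _)
        (Submodule.add_mem _ (hg x) (hg y)) (by simp [hYg])
      map_smul' := fun c x => eq_of_mem_orthogonal_ker (hg _)
        (Submodule.smul_mem _ c (hg x)) (by simp [hYg]) }
  let D : E →L[ℂ] F := ContinuousLinearMap.ofSeqClosedGraph (g := gl) (by
    intro u x y hu hgu
    have hy : y ∈ Y.kerᗮ :=
      (Submodule.isClosed_orthogonal Y.ker).mem_of_tendsto hgu
        (Filter.Eventually.of_forall fun n => hg (u n))
    refine eq_of_mem_orthogonal_ker hy (hg x) ?_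
    have h1 : Filter.Tendsto (fun n => Z (u n)) Filter.atTop (nhds (Y y)) := by
      have := (Y.continuous.tendsto y).comp hgu
      refine this.congr fun n => ?_
      exact hYg (u n)
    have h2 : Filter.Tendsto (fun n => Z (u n)) Filter.atTop (nhds (Z x)) :=
      (Z.continuous.tendsto x).comp hu
    rw [tendsto_nhds_unique h1 h2]
    exact (hYg x).symm)
  have hD : ∀ x, D x = g x := fun _ => rfl
  refine ⟨D, ⟨?_, ?_, ?_⟩, ?_⟩
  · ext x
    exact hYg x
  · ext x
    change D x = 0 ↔ Z x = 0
    rw [hD, ← hYg]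
    constructor
    · intro h0
      rw [h0, map_zero]
    · intro h0
      exact eq_of_mem_orthogonal_ker (Y := Y) (hg x) (Submodule.zero_mem _) (by simp [h0])
  · rw [← ContinuousLinearMap.orthogonal_ker]
    rintro _ ⟨x, rfl⟩
    exact hg x
  · intro D' hD'
    ext x
    have hmem : D' x ∈ Y.kerᗮ := by
      rw [ContinuousLinearMap.orthogonal_ker]
      exact hD'.range_le (LinearMap.mem_range_self _ x)
    refine eq_of_mem_orthogonal_ker hmem (hg x) ?_
    rw [hD, hYg, ← hD'.comp_eq]
    rfl

/-- The reduced solution of `Z = Y X`, given `R(Z) ⊆ R(Y)`. -/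
noncomputable def reducedSolution (Y : F →L[ℂ] G) (Z : E →L[ℂ] G) (h : Z.range ≤ Y.range) :
    E →L[ℂ] F :=
  (existsUnique_isReducedSolution Y Z h).choose

/-- The modulus of an operator is norm-preserving in the sense `‖|T| x‖ = ‖T x‖`. -/
theorem norm_abs_apply (T : E →L[ℂ] E) (x : E) : ‖CFC.abs T x‖ = ‖T x‖ := by
  have hsa : adjoint (CFC.abs T) = CFC.abs T := (CFC.abs_nonneg T).isSelfAdjoint
  have h1 : adjoint (CFC.abs T) ∘L CFC.abs T = adjoint T ∘L T := by
    rw [hsa]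
    exact CFC.abs_mul_abs T
  have h2 : ‖CFC.abs T x‖ ^ 2 = ‖T x‖ ^ 2 := by
    rw [ContinuousLinearMap.apply_norm_sq_eq_inner_adjoint_left,
      ContinuousLinearMap.apply_norm_sq_eq_inner_adjoint_left, h1]
  exact (sq_eq_sq₀ (norm_nonneg _) (norm_nonneg _)).mp h2

/-- The polar decomposition exists and its partial isometry is unique. -/
theorem existsUnique_isPolarFactor (T : E →L[ℂ] E) : ∃! U : E →L[ℂ] E, IsPolarFactor T U := by
  have hsa : adjoint (CFC.abs T) = CFC.abs T := (CFC.abs_nonneg T).isSelfAdjoint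
  have hker : (CFC.abs T).ker = T.ker := by
    ext x
    change CFC.abs T x = 0 ↔ T x = 0
    rw [← norm_eq_zero, norm_abs_apply, norm_eq_zero]
  set K : Submodule ℂ E := (CFC.abs T).range.topologicalClosure with hK
  have hKker : T.kerᗮ = K := by
    rw [← hker, ContinuousLinearMap.orthogonal_ker, hsa]
  have hKc : IsClosed (K : Set E) := Submodule.isClosed_topologicalClosure _
  have : CompleteSpace K := hKc.completeSpace_coe
  have hKperp : Kᗮ = T.ker := by
    rw [← hKker]
    exact Submodule.orthogonal_orthogonal T.ker
  have hmem : ∀ x, CFC.abs T x ∈ K := fun x =>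
    Submodule.le_topologicalClosure _ (LinearMap.mem_range_self _ x)
  let e : E →ₗ[ℂ] K := (CFC.abs T).toLinearMap.codRestrict K hmem
  have he : ∀ x, (e x : E) = CFC.abs T x := fun _ => rfl
  have hdense : DenseRange e := by
    intro z
    rw [closure_subtype]
    have hz : (z : E) ∈ closure ((CFC.abs T).range : Set E) := z.2
    convert hz using 2
    ext y
    constructor
    · rintro ⟨_, ⟨x, rfl⟩, rfl⟩
      exact ⟨x, rfl⟩
    · rintro ⟨x, rfl⟩
      exact ⟨e x, ⟨x, rfl⟩, rfl⟩
  have hnorm : ∀ x, ‖T.toLinearMap x‖ = ‖e x‖ := fun x => (norm_abs_apply T x).symm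
  let V : K →L[ℂ] E := T.toLinearMap.extendOfNorm e
  have hV : ∀ x, V (e x) = T x := fun x =>
    LinearMap.extendOfNorm_eq hdense ⟨1, fun x => by rw [hnorm, one_mul]⟩ x
  have hViso : ∀ z, ‖V z‖ = ‖z‖ := by
    intro z
    refine hdense.induction_on (p := fun z => ‖V z‖ = ‖z‖) z
      (isClosed_eq (by fun_prop) (by fun_prop)) ?_
    intro x
    rw [hV]
    exact hnorm x
  let U : E →L[ℂ] E := V ∘L K.orthogonalProjectionOnto
  have hUK : ∀ z : K, U z = V z := by
    intro z
    change V (K.orthogonalProjectionOnto (z : E)) = V z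
    simp
  have hUker : U.ker = T.ker := by
    rw [← hKperp]
    ext x
    change V (K.orthogonalProjectionOnto x) = 0 ↔ _
    rw [← norm_eq_zero, hViso, norm_eq_zero]
    exact Submodule.orthogonalProjectionOnto_eq_zero_iff
  refine ⟨U, ⟨?_, hUker, ?_⟩, ?_⟩
  · intro x hx
    rw [hUker, hKker] at hx
    have := hUK ⟨x, hx⟩
    change U x = _ at this
    rw [this, hViso]
    rfl
  · ext x
    exact (hUK (e x)).trans (hV x)
  · intro W hW
    have hWK : ∀ z : K, W z = U z := by
      intro z
      refine hdense.induction_on (p := fun z : K => W z = U z) z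
        (isClosed_eq (by fun_prop) (by fun_prop)) ?_
      intro x
      rw [hUK, hV]
      exact congrArg (fun A : E →L[ℂ] E => A x) hW.comp_abs
    ext x
    have hx1 : x - K.starProjection x ∈ T.ker := by
      rw [← hKperp]
      exact Submodule.sub_starProjection_mem_orthogonal x
    have h1 : W (x - K.starProjection x) = 0 := by
      have := hx1
      rw [← hW.ker_eq] at this
      exact this
    have h2 : U (x - K.starProjection x) = 0 := by
      have := hx1
      rw [← hUker] at this
      exact this
    have h3 : W (K.starProjection x) = U (K.starProjection x) :=
      hWK (K.orthogonalProjectionOnto x)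
    rw [map_sub, sub_eq_zero] at h1 h2
    rw [h1, h2, h3]

/-- The partial isometry `u` of the polar decomposition `T = u |T|` with `N(u) = N(T)`. -/
noncomputable def polarFactor (T : E →L[ℂ] E) : E →L[ℂ] E :=
  (existsUnique_isPolarFactor T).choose

end Factorization

section Schur

variable {H : Type*} [NormedAddCommGroup H] [InnerProductSpace ℂ H] [CompleteSpace H]

/-- The block of `B` mapping `N` to `M`, i.e. the compression `P_M B|_N`. -/
noncomputable def block (B : H →L[ℂ] H) (M N : Submodule ℂ H) [CompleteSpace M] : N →L[ℂ] M :=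
  M.orthogonalProjectionOnto ∘L B ∘L N.subtypeL

/-- With `B = [a b; b* c]` relative to `S ⊕ Sᗮ`, the operator `B` is `S`-weakly complementable
if `R(b) ⊆ R(|a|^(1/2))`. Here `S` is a closed subspace, expressed by `CompleteSpace S`. -/
def IsWeaklyComplementable (B : H →L[ℂ] H) (S : Submodule ℂ H) [CompleteSpace S] : Prop :=
  (block B S Sᗮ).range ≤ (modulusSqrt (block B S S)).range

/-- The Schur complement `[0 0; 0 c - f* u f]` of an `S`-weakly complementable operator
`B = [a b; b* c]`, where `f` is the reduced solution of `b = |a|^(1/2) x` and `a = u |a|` is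
the polar decomposition of `a`. -/
noncomputable def schurComplement (B : H →L[ℂ] H) (S : Submodule ℂ H) [CompleteSpace S]
    (h : IsWeaklyComplementable B S) : H →L[ℂ] H :=
  let f : Sᗮ →L[ℂ] S := reducedSolution (modulusSqrt (block B S S)) (block B S Sᗮ) h
  let u : S →L[ℂ] S := polarFactor (block B S S)
  Sᗮ.subtypeL ∘L (block B Sᗮ Sᗮ - adjoint f ∘L u ∘L f) ∘L Sᗮ.orthogonalProjectionOnto

/-- `S = Sp ⊕_B Sm`, where `Sp` and `Sm` are closed, orthogonal and `B`-orthogonal, `Sp` is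
`B`-nonnegative and `Sm` is `B`-nonpositive. -/
structure IsSignDecomposition (B : H →L[ℂ] H) (S Sp Sm : Submodule ℂ H) : Prop where
  isClosed_pos : IsClosed (Sp : Set H)
  isClosed_neg : IsClosed (Sm : Set H)
  sup_eq : Sp ⊔ Sm = S
  orthogonal : ∀ s ∈ Sp, ∀ t ∈ Sm, inner ℂ s t = 0
  B_orthogonal : ∀ s ∈ Sp, ∀ t ∈ Sm, inner ℂ (B s) t = 0
  nonneg : ∀ s ∈ Sp, 0 ≤ (inner ℂ (B s) s).re
  nonpos : ∀ s ∈ Sm, (inner ℂ (B s) s).re ≤ 0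

/-- `M⁻(B, T)`: the selfadjoint `X ≤ B` (Loewner order) with `R(X) ⊆ T`. -/
def lowerSet (B : H →L[ℂ] H) (T : Submodule ℂ H) : Set (H →L[ℂ] H) :=
  {X | IsSelfAdjoint X ∧ X ≤ B ∧ X.range ≤ T}

/-- `M⁺(B, T)`: the selfadjoint `X ≥ B` (Loewner order) with `R(X) ⊆ T`. -/
def upperSet (B : H →L[ℂ] H) (T : Submodule ℂ H) : Set (H →L[ℂ] H) :=
  {X | IsSelfAdjoint X ∧ B ≤ X ∧ X.range ≤ T}

/-- `min M⁺(max M⁻(B, Spᗮ), Smᗮ)` exists and equals `Y`. -/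
def IsMinMax (B : H →L[ℂ] H) (Sp Sm : Submodule ℂ H) (Y : H →L[ℂ] H) : Prop :=
  ∃ X, IsGreatest (lowerSet B Spᗮ) X ∧ IsLeast (upperSet X Smᗮ) Y

/-- `max M⁻(min M⁺(B, Smᗮ), Spᗮ)` exists and equals `Y`. -/
def IsMaxMin (B : H →L[ℂ] H) (Sp Sm : Submodule ℂ H) (Y : H →L[ℂ] H) : Prop :=
  ∃ X, IsLeast (upperSet B Smᗮ) X ∧ IsGreatest (lowerSet X Spᗮ) Y

end Schur

end SchurMinMax

/-! Let `p` be the orthogonal projection of S onto S₊ and J = p - (1 - p). Since `p` splits the form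
of a into a nonnegative and a nonpositive part, a commutes with `p`, |a| = aJ, a = |a|^(1/2) J
|a|^(1/2), and the polar factor u agrees with J on the closure of R(|a|^(1/2))
(`IsSignProjection.abs_eq`, `IsSignProjection.polarFactor_apply`).

If b = |a|^(1/2) f, put W = |a|^(1/2) P_S + J f P_{Sᗮ}. Completing the square gives B = C + W* J W
with C the Schur complement, that is, B = C + G*G - L*L with G = pW and L = (1 - p)W
(`IsSignDecomposition.exists_factorization`). Here G vanishes on S₋, L vanishes on S₊, and G(S₊),
L(S₋) are dense in R(G), R(L). By the extremality criterion `isGreatest_lowerSet` and its mirror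
image `isLeast_upperSet`, the inner maximum is C - L*L, the inner minimum is C + G*G, and both outer
extrema are C.

Conversely, any X ≤ B vanishing on S₊ gives a Cauchy-Schwarz bound for ⟨By, t⟩ on S₊, and any Y ≥ B
vanishing on S₋ gives one on S₋. Together they bound ⟨by, s⟩ by a multiple of ‖|a|^(1/2) s‖, which
puts by in R(|a|^(1/2)). -/

namespace SchurMinMax

/-! ### Sign projections, the modulus and the polar factor. -/

section SignProjection

variable {E F : Type*}
  [NormedAddCommGroup E] [InnerProductSpace ℂ E] [CompleteSpace E]
  [NormedAddCommGroup F] [InnerProductSpace ℂ F] [CompleteSpace F]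

/-- A vector `v` with `|⟨v, x⟩| ≤ C ‖Y x‖` for all `x` lies in the range of `Y*`. -/
theorem mem_range_adjoint_of_norm_inner_le (Y : E →L[ℂ] F) (v : E) (C : ℝ)
    (h : ∀ x, ‖inner ℂ v x‖ ≤ C * ‖Y x‖) : v ∈ (adjoint Y).range := by
  set K : Submodule ℂ F := Y.range.topologicalClosure
  have : CompleteSpace K := (Submodule.isClosed_topologicalClosure _).completeSpace_coe
  let e : E →ₗ[ℂ] K := Y.toLinearMap.codRestrict K fun x =>
    Submodule.le_topologicalClosure _ (LinearMap.mem_range_self _ x)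
  have hdense : DenseRange e := by
    intro z
    rw [closure_subtype]
    have hz : (z : F) ∈ closure (Y.range : Set F) := z.2
    convert hz using 2
    ext y
    constructor
    · rintro ⟨_, ⟨x, rfl⟩, rfl⟩
      exact ⟨x, rfl⟩
    · rintro ⟨x, rfl⟩
      exact ⟨e x, ⟨x, rfl⟩, rfl⟩
  -- The bound makes Y x ↦ ⟨v, x⟩ a well-defined bounded functional on the closure of R(Y); its
  -- Riesz vector w satisfies Y* w = v.
  let V : K →L[ℂ] ℂ := (innerSL ℂ v).toLinearMap.extendOfNorm e
  have hV : ∀ x, V (e x) = inner ℂ v x := fun x =>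
    LinearMap.extendOfNorm_eq hdense ⟨C, fun x => h x⟩ x
  let w : K := (InnerProductSpace.toDual ℂ K).symm V
  refine ⟨(w : F), ext_inner_right ℂ fun x => ?_⟩
  have : inner ℂ w (e x) = V (e x) := InnerProductSpace.toDual_symm_apply
  rw [hV] at this
  rw [← this]
  exact adjoint_inner_left Y x (w : F)

/-- `p` is an orthogonal projection commuting with the selfadjoint operator `a`, which is
nonnegative on `R(p)` and nonpositive on `N(p)`. -/
structure IsSignProjection (a p : E →L[ℂ] E) : Prop where
  isSelfAdjoint : IsSelfAdjoint a
  isStarProjection : IsStarProjection p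
  commute : Commute a p
  nonneg : 0 ≤ p * a * p
  nonpos : (1 - p) * a * (1 - p) ≤ 0

theorem adjoint_modulusSqrt (a : E →L[ℂ] E) : adjoint (modulusSqrt a) = modulusSqrt a :=
  (CFC.sqrt_nonneg (CFC.abs a)).isSelfAdjoint

theorem modulusSqrt_mul_self (a : E →L[ℂ] E) : modulusSqrt a * modulusSqrt a = CFC.abs a :=
  CFC.sqrt_mul_sqrt_self _ (CFC.abs_nonneg a)

theorem norm_modulusSqrt_apply_sq (a : E →L[ℂ] E) (x : E) :
    ‖modulusSqrt a x‖ ^ 2 = (inner ℂ (CFC.abs a x) x).re := by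
  have : adjoint (modulusSqrt a) ∘L modulusSqrt a = CFC.abs a := by
    rw [adjoint_modulusSqrt]
    exact modulusSqrt_mul_self a
  rw [apply_norm_sq_eq_inner_adjoint_left, this]
  rfl

theorem ker_modulusSqrt (a : E →L[ℂ] E) : (modulusSqrt a).ker = (CFC.abs a).ker := by
  ext x
  change modulusSqrt a x = 0 ↔ CFC.abs a x = 0
  constructor
  · intro h
    rw [← modulusSqrt_mul_self, mul_apply_eq_comp, h, map_zero]
  · intro h
    have := norm_modulusSqrt_apply_sq a x
    rw [h, inner_zero_left] at this
    simpa using this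

namespace IsSignProjection

variable {a p : E →L[ℂ] E}

theorem symmetry_mul_self (h : IsSignProjection a p) :
    (p - (1 - p)) * (p - (1 - p)) = 1 := by
  have hp : p * p = p := h.isStarProjection.isIdempotentElem
  simp only [sub_mul, mul_sub, mul_one, one_mul, hp]
  abel

theorem adjoint_projection (h : IsSignProjection a p) : adjoint p = p :=
  h.isStarProjection.isSelfAdjoint

theorem adjoint_symmetry (h : IsSignProjection a p) :
    adjoint (p - (1 - p)) = p - (1 - p) := by
  have h1 : adjoint (1 : E →L[ℂ] E) = 1 := star_one _
  rw [map_sub, map_sub, h.adjoint_projection, h1]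

/-- J commutes with a and J² = 1, so (aJ)² = a². Moreover aJ = ap - a(1 - p) ≥ 0, and the
nonnegative square root is unique. -/
theorem abs_eq (h : IsSignProjection a p) : CFC.abs a = a * (p - (1 - p)) := by
  have hp : p * p = p := h.isStarProjection.isIdempotentElem
  have hap : a * p = p * a := h.commute
  have h1 : p * a * p = a * p := by rw [← hap, mul_assoc, hp]
  have h2 : (1 - p) * a * (1 - p) = a * (1 - p) := by
    simp only [sub_mul, mul_sub, mul_one, one_mul, h1]
    rw [← hap]
    abel
  have hJ : Commute a (p - (1 - p)) :=
    h.commute.sub_right ((Commute.one_right a).sub_right h.commute)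
  refine CFC.sqrt_unique ?_ ?_
  · rw [h.isSelfAdjoint.star_eq, mul_assoc, ← mul_assoc _ a, ← hJ.eq, mul_assoc a (p - (1 - p)),
      h.symmetry_mul_self, mul_one]
  · rw [mul_sub]
    have h3 := h.nonneg
    have h4 := h.nonpos
    rw [h1] at h3
    rw [h2] at h4
    exact sub_nonneg.mpr (h4.trans h3)

theorem commute_abs (h : IsSignProjection a p) : Commute (CFC.abs a) p := by
  rw [h.abs_eq]
  exact h.commute.mul_left
    ((Commute.refl p).sub_left ((Commute.one_left p).sub_left (Commute.refl p)))

theorem commute_modulusSqrt (h : IsSignProjection a p) : Commute (modulusSqrt a) p :=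
  h.commute_abs.cfcₙ_nnreal _

theorem modulusSqrt_projection_apply (h : IsSignProjection a p) (x : E) :
    modulusSqrt a (p x) = p (modulusSqrt a x) :=
  congrArg (fun A : E →L[ℂ] E => A x) h.commute_modulusSqrt.eq

theorem eq_symmetry_mul_abs (h : IsSignProjection a p) : a = (p - (1 - p)) * CFC.abs a := by
  have hJ : Commute a (p - (1 - p)) :=
    h.commute.sub_right ((Commute.one_right a).sub_right h.commute)
  rw [h.abs_eq, hJ.eq, ← mul_assoc, h.symmetry_mul_self, one_mul]

theorem apply_eq_modulusSqrt (h : IsSignProjection a p) (x : E) :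
    a x = modulusSqrt a ((p - (1 - p)) (modulusSqrt a x)) := by
  have hJ : Commute (modulusSqrt a) (p - (1 - p)) :=
    h.commute_modulusSqrt.sub_right
      ((Commute.one_right _).sub_right h.commute_modulusSqrt)
  have : a = modulusSqrt a * ((p - (1 - p)) * modulusSqrt a) := by
    rw [← mul_assoc, hJ.eq, mul_assoc, modulusSqrt_mul_self]
    exact h.eq_symmetry_mul_abs
  exact congrArg (fun A : E →L[ℂ] E => A x) this

/-- The polar factor of `a` agrees with the symmetry `p - (1 - p)` on `N(a)ᗮ`. -/
theorem polarFactor_apply (h : IsSignProjection a p) {x : E}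
    (hx : x ∈ (adjoint (modulusSqrt a)).range.topologicalClosure) :
    polarFactor a x = (p - (1 - p)) x := by
  have hu : IsPolarFactor a (polarFactor a) := (existsUnique_isPolarFactor a).choose_spec.1
  -- |a|^(1/2) and |a| have the same nullspace, hence the same range closure. On R(|a|) both sides
  -- agree because u|a| = a = J|a|; continuity does the rest.
  rw [← ContinuousLinearMap.orthogonal_ker, ker_modulusSqrt,
    ContinuousLinearMap.orthogonal_ker] at hx
  have hsa : adjoint (CFC.abs a) = CFC.abs a := (CFC.abs_nonneg a).isSelfAdjoint
  rw [hsa] at hx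
  have hcl : IsClosed {x : E | polarFactor a x = (p - (1 - p)) x} :=
    isClosed_eq (by fun_prop) (by fun_prop)
  refine closure_minimal (s := ((CFC.abs a).range : Set E)) ?_ hcl hx
  rintro _ ⟨y, rfl⟩
  have h1 := congrArg (fun A : E →L[ℂ] E => A y) hu.comp_abs
  have h2 := congrArg (fun A : E →L[ℂ] E => A y) h.eq_symmetry_mul_abs
  exact h1.trans h2

theorem abs_apply (h : IsSignProjection a p) (x : E) : CFC.abs a x = a (p x - (x - p x)) := by
  rw [h.abs_eq]
  rfl

theorem projection_projection_apply (h : IsSignProjection a p) (x : E) : p (p x) = p x :=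
  congrArg (fun A : E →L[ℂ] E => A x) h.isStarProjection.isIdempotentElem

/-- On R(p) the modulus |a| coincides with a. This turns the Cauchy-Schwarz bounds in ⟨Bt, t⟩^(1/2)
into bounds in terms of |a|^(1/2). -/
theorem norm_projection_modulusSqrt_apply (h : IsSignProjection a p) (x : E) :
    ‖p (modulusSqrt a x)‖ = √(inner ℂ (a (p x)) (p x)).re := by
  rw [← h.modulusSqrt_projection_apply, ← Real.sqrt_sq (norm_nonneg (modulusSqrt a (p x))),
    norm_modulusSqrt_apply_sq, h.abs_apply, h.projection_projection_apply, sub_self, sub_zero]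

theorem norm_sub_projection_modulusSqrt_apply (h : IsSignProjection a p) (x : E) :
    ‖modulusSqrt a x - p (modulusSqrt a x)‖ = √(-(inner ℂ (a (x - p x)) (x - p x)).re) := by
  have h1 : p (x - p x) = 0 := by
    rw [map_sub p, h.projection_projection_apply, sub_self]
  have h2 : CFC.abs a (x - p x) = -a (x - p x) := by
    rw [h.abs_apply, h1, sub_zero, zero_sub, map_neg]
  rw [← h.modulusSqrt_projection_apply, ← map_sub (modulusSqrt a),
    ← Real.sqrt_sq (norm_nonneg (modulusSqrt a (x - p x))), norm_modulusSqrt_apply_sq, h2,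
    inner_neg_left, Complex.neg_re]

theorem norm_projection_apply_le (h : IsSignProjection a p) (x : E) : ‖p x‖ ≤ ‖x‖ :=
  (p.le_of_opNorm_le h.isStarProjection.norm_le x).trans_eq (one_mul _)

theorem norm_sub_projection_apply_le (h : IsSignProjection a p) (x : E) : ‖x - p x‖ ≤ ‖x‖ :=
  ((1 - p).le_of_opNorm_le h.isStarProjection.one_sub.norm_le x).trans_eq (one_mul _)

/-- An orthogonal projection splitting the form `⟨a x, y⟩` into a nonnegative and a nonpositive
part is a sign projection of `a`. -/
theorem of_inner (ha : IsSelfAdjoint a) (hp : IsStarProjection p)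
    (horth : ∀ x y, inner ℂ (a (p x)) (y - p y) = 0)
    (hpos : ∀ x, 0 ≤ (inner ℂ (a (p x)) (p x)).re)
    (hneg : ∀ x, (inner ℂ (a (x - p x)) (x - p x)).re ≤ 0) : IsSignProjection a p := by
  have hpa : adjoint p = p := hp.isSelfAdjoint
  have hqa : adjoint (1 - p) = 1 - p := hp.one_sub.isSelfAdjoint
  have h1 : (1 - p) * a * p = 0 := by
    ext1 s
    refine ext_inner_right ℂ fun t => ?_
    have : ((1 - p) * a * p) s = adjoint (1 - p) (a (p s)) := by rw [hqa]; rfl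
    rw [this, adjoint_inner_left, zero_apply, inner_zero_left]
    exact horth s t
  -- The other off-diagonal block vanishes by taking adjoints; the two together say that a commutes
  -- with p.
  have h2 : p * a * (1 - p) = 0 := by
    have := congrArg star h1
    rwa [star_mul, star_mul, hp.isSelfAdjoint.star_eq, ha.star_eq,
      hp.one_sub.isSelfAdjoint.star_eq, star_zero, ← mul_assoc] at this
  have hap : Commute a p := by
    simp only [sub_mul, mul_sub, one_mul, mul_one, sub_eq_zero] at h1 h2
    exact h1.trans h2.symm
  refine ⟨ha, hp, hap, ?_, ?_⟩
  · rw [nonneg_iff_isPositive, isPositive_def']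
    refine ⟨?_, fun s => ?_⟩
    · have := ha.conjugate p
      rwa [hp.isSelfAdjoint.star_eq] at this
    · have : (p * a * p) s = adjoint p (a (p s)) := by rw [hpa]; rfl
      rw [reApplyInnerSelf_apply, this, adjoint_inner_left]
      exact hpos s
  · rw [← neg_nonneg, nonneg_iff_isPositive, isPositive_def']
    refine ⟨?_, fun s => ?_⟩
    · have := (ha.conjugate (1 - p)).neg
      rwa [hp.one_sub.isSelfAdjoint.star_eq] at this
    · have : ((1 - p) * a * (1 - p)) s = adjoint (1 - p) (a ((1 - p) s)) := by rw [hqa]; rfl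
      rw [reApplyInnerSelf_apply, neg_apply, this, inner_neg_left, adjoint_inner_left, map_neg]
      exact neg_nonneg.mpr (hneg s)

/-- The quadratic-form identity behind the factorization of the Schur complement. -/
theorem norm_sq_sub_norm_sq (h : IsSignProjection a p) (x v : E) :
    let w := modulusSqrt a x + (p v - (v - p v))
    inner ℂ (p w) (p w) - inner ℂ (w - p w) (w - p w) =
      inner ℂ (a x) x + inner ℂ (modulusSqrt a v) x + inner ℂ x (modulusSqrt a v)
        + inner ℂ (p v - (v - p v)) v := by
  intro w
  have hJ := h.adjoint_symmetry
  set J : E →L[ℂ] E := p - (1 - p) with hJdef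
  have hJJ : ∀ y, J (J y) = y := fun y =>
    congrArg (fun A : E →L[ℂ] E => A y) h.symmetry_mul_self
  have hJi : ∀ y z, inner ℂ (J y) z = inner ℂ y (J z) := fun y z => by
    rw [← adjoint_inner_left, hJ]
  have hQi : ∀ y z, inner ℂ (modulusSqrt a y) z = inner ℂ y (modulusSqrt a z) := fun y z => by
    rw [← adjoint_inner_left, adjoint_modulusSqrt]
  have hpi : ∀ y z, inner ℂ (p y) z = inner ℂ y (p z) := fun y z => by
    rw [← adjoint_inner_left, h.adjoint_projection]
  have hw : w = modulusSqrt a x + J v := rfl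
  have h1 : inner ℂ (p w) (p w) - inner ℂ (w - p w) (w - p w) = inner ℂ (J w) w := by
    have e1 : inner ℂ (p w) (p w) = inner ℂ (p w) w := by
      rw [← hpi, h.projection_projection_apply]
    have e2 : inner ℂ w (p w) = inner ℂ (p w) w := (hpi w w).symm
    have e3 : J w = p w - (w - p w) := rfl
    rw [e3]
    simp only [inner_sub_left, inner_sub_right, e1, e2]
    ring
  have h2 : inner ℂ (a x) x = inner ℂ (J (modulusSqrt a x)) (modulusSqrt a x) := by
    nth_rw 1 [h.apply_eq_modulusSqrt x]
    exact hQi _ _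
  have h3 : p v - (v - p v) = J v := rfl
  -- The left side is ⟨Jw, w⟩ with w = |a|^(1/2) x + Jv. The J in front of v is chosen so that J² =
  -- 1 removes J from the cross terms.
  rw [h1, h2, h3, hw, map_add, hJJ, inner_add_left, inner_add_right, inner_add_right,
    hQi v x, ← hQi x v, hJi (modulusSqrt a x) (J v), hJJ, hJi v v]
  ring

/-- Source of the density of G(S₊) in R(G): p is continuous and commutes with |a|^(1/2). -/
theorem projection_mem_closure (h : IsSignProjection a p) {x : E}
    (hx : x ∈ (adjoint (modulusSqrt a)).range.topologicalClosure) :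
    p x ∈ closure (Set.range fun y => modulusSqrt a (p y)) := by
  rw [adjoint_modulusSqrt] at hx
  refine map_mem_closure p.continuous hx ?_
  rintro _ ⟨y, rfl⟩
  exact ⟨y, h.modulusSqrt_projection_apply y⟩

theorem sub_projection_mem_closure (h : IsSignProjection a p) {x : E}
    (hx : x ∈ (adjoint (modulusSqrt a)).range.topologicalClosure) :
    x - p x ∈ closure (Set.range fun y => modulusSqrt a (y - p y)) := by
  rw [adjoint_modulusSqrt] at hx
  refine map_mem_closure (f := fun x => x - p x) (by fun_prop) hx ?_
  rintro _ ⟨y, rfl⟩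
  refine ⟨y, ?_⟩
  change modulusSqrt a (y - p y) = modulusSqrt a y - p (modulusSqrt a y)
  rw [map_sub (modulusSqrt a), h.modulusSqrt_projection_apply]

theorem symmetry_apply_mem (h : IsSignProjection a p) {x : E}
    (hx : x ∈ (adjoint (modulusSqrt a)).range.topologicalClosure) :
    p x - (x - p x) ∈ (adjoint (modulusSqrt a)).range.topologicalClosure := by
  have hpx : p x ∈ (adjoint (modulusSqrt a)).range.topologicalClosure := by
    refine closure_mono ?_ (h.projection_mem_closure hx)
    rintro _ ⟨y, rfl⟩
    rw [adjoint_modulusSqrt]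
    exact ⟨p y, rfl⟩
  exact Submodule.sub_mem _ hpx (Submodule.sub_mem _ hx hpx)

end IsSignProjection

end SignProjection

/-! ### Extremal elements of the operator sets M⁻ and M⁺. -/

section Extremal

variable {H K : Type*}
  [NormedAddCommGroup H] [InnerProductSpace ℂ H] [CompleteSpace H]
  [NormedAddCommGroup K] [InnerProductSpace ℂ K] [CompleteSpace K]

theorem apply_eq_zero_of_range_le_orthogonal {X : H →L[ℂ] H} (hX : IsSelfAdjoint X)
    {T : Submodule ℂ H} (h : X.range ≤ Tᗮ) {t : H} (ht : t ∈ T) : X t = 0 := by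
  refine ext_inner_right ℂ fun x => ?_
  have hX' : adjoint X = X := hX
  rw [inner_zero_left, ← hX', adjoint_inner_left]
  exact Submodule.inner_right_of_mem_orthogonal ht (h (LinearMap.mem_range_self _ x))

theorem range_le_orthogonal_of_apply_eq_zero {X : H →L[ℂ] H} (hX : IsSelfAdjoint X)
    {T : Submodule ℂ H} (h : ∀ t ∈ T, X t = 0) : X.range ≤ Tᗮ := by
  rintro _ ⟨x, rfl⟩
  refine (Submodule.mem_orthogonal _ _).mpr fun t ht => ?_
  have hX' : adjoint X = X := hX
  change inner ℂ t (X x) = 0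
  rw [← adjoint_inner_left, hX', h t ht, inner_zero_left]

/-- If `B - X = G* G` where `R(G)` lies in the closure of `G(T)`, then `X` is the greatest
selfadjoint operator below `B` with range in `Tᗮ`. -/
theorem isGreatest_lowerSet {B X : H →L[ℂ] H} {G : H →L[ℂ] K} {T : Submodule ℂ H}
    (hX : IsSelfAdjoint X) (hXT : ∀ t ∈ T, X t = 0) (hB : B = X + adjoint G ∘L G)
    (hG : ∀ z, G z ∈ closure (G '' T)) : IsGreatest (lowerSet B Tᗮ) X := by
  refine ⟨⟨hX, ?_, range_le_orthogonal_of_apply_eq_zero hX hXT⟩, ?_⟩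
  · rw [le_def, hB, add_sub_cancel_left]
    exact isPositive_adjoint_comp_self G
  rintro Y ⟨hY, hYB, hYT⟩
  have hYT' : ∀ t ∈ T, Y t = 0 := fun t ht => apply_eq_zero_of_range_le_orthogonal hY hYT ht
  -- The form of a selfadjoint operator vanishing on T is unchanged when z is translated by T.
  have shift : ∀ Z : H →L[ℂ] H, IsSelfAdjoint Z → (∀ t ∈ T, Z t = 0) → ∀ z, ∀ t ∈ T,
      inner ℂ (Z (z - t)) (z - t) = inner ℂ (Z z) z := by
    intro Z hZ hZT z t ht
    have hZ' : adjoint Z = Z := hZ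
    have h0 : inner ℂ (Z z) t = 0 := by
      rw [← hZ', adjoint_inner_left, hZT t ht, inner_zero_right]
    rw [map_sub, hZT t ht, sub_zero, inner_sub_right, h0, sub_zero]
  rw [le_def, isPositive_def']
  refine ⟨hX.sub hY, fun z => ?_⟩
  rw [reApplyInnerSelf_apply, sub_apply, inner_sub_left, map_sub]
  refine le_of_forall_pos_le_add fun ε hε => ?_
  obtain ⟨_, ⟨t, ht, rfl⟩, hd⟩ := Metric.mem_closure_iff.mp (hG z) (√ε) (Real.sqrt_pos.mpr hε)
  -- Positivity of B - Y at z - t reads 0 ≤ ⟨(X - Y)z, z⟩ + ‖Gz - Gt‖², and t was chosen to make the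
  -- last term smaller than ε.
  have h1 := (le_def _ _).mp hYB |>.re_inner_nonneg_left (z - t)
  rw [hB, sub_apply, add_apply, inner_sub_left, inner_add_left, shift X hX hXT z t ht,
    shift Y hY hYT' z t ht, comp_apply, adjoint_inner_left] at h1
  have h2 : dist (G z) (G t) ^ 2 < ε := by
    rw [← Real.sq_sqrt hε.le]
    exact pow_lt_pow_left₀ hd dist_nonneg two_ne_zero
  rw [dist_eq_norm] at h2
  simp only [map_sub, map_add, inner_self_eq_norm_sq] at h1
  linarith

/-- The symmetry X ↦ -X reduces every statement about minima to one about maxima. -/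
theorem neg_mem_lowerSet_neg {B X : H →L[ℂ] H} {T : Submodule ℂ H} :
    -X ∈ lowerSet (-B) T ↔ X ∈ upperSet B T := by
  have : (-X).range = X.range := LinearMap.range_neg _
  have hs : IsSelfAdjoint (-X) ↔ IsSelfAdjoint X :=
    ⟨fun h => by simpa using h.neg, fun h => h.neg⟩
  change IsSelfAdjoint (-X) ∧ -X ≤ -B ∧ (-X).range ≤ T ↔ IsSelfAdjoint X ∧ B ≤ X ∧ X.range ≤ T
  rw [this, neg_le_neg_iff, hs]

theorem isGreatest_lowerSet_neg {B X : H →L[ℂ] H} {T : Submodule ℂ H} :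
    IsGreatest (lowerSet (-B) T) (-X) ↔ IsLeast (upperSet B T) X := by
  refine and_congr neg_mem_lowerSet_neg ⟨fun h Y hY => ?_, fun h Y hY => ?_⟩
  · exact neg_le_neg_iff.mp (h (neg_mem_lowerSet_neg.mpr hY))
  · rw [← neg_neg Y] at hY ⊢
    exact neg_le_neg (h (neg_mem_lowerSet_neg.mp hY))

/-- If `X - B = G* G` where `R(G)` lies in the closure of `G(T)`, then `X` is the least
selfadjoint operator above `B` with range in `Tᗮ`. -/
theorem isLeast_upperSet {B X : H →L[ℂ] H} {G : H →L[ℂ] K} {T : Submodule ℂ H}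
    (hX : IsSelfAdjoint X) (hXT : ∀ t ∈ T, X t = 0) (hB : X = B + adjoint G ∘L G)
    (hG : ∀ z, G z ∈ closure (G '' T)) : IsLeast (upperSet B Tᗮ) X := by
  refine isGreatest_lowerSet_neg.mp (isGreatest_lowerSet hX.neg ?_ ?_ hG)
  · intro t ht
    rw [neg_apply, hXT t ht, neg_zero]
  · rw [hB]
    abel

/-- If `M⁻(B, Tᗮ)` is nonempty, then every vector `y` satisfies
`|⟨B y, t⟩| ≤ C ⟨B t, t⟩^(1/2)` on `T`. -/
theorem exists_norm_inner_le_of_mem_lowerSet {B X : H →L[ℂ] H} {T : Submodule ℂ H}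
    (hX : X ∈ lowerSet B Tᗮ) (y : H) :
    ∃ C, 0 ≤ C ∧ ∀ t ∈ T, ‖inner ℂ (B y) t‖ ≤ C * √(inner ℂ (B t) t).re := by
  obtain ⟨hXs, hXB, hXT⟩ := hX
  have hX' : adjoint X = X := hXs
  have h0 : 0 ≤ B - X := sub_nonneg.mpr hXB
  set G : H →L[ℂ] H := CFC.sqrt (B - X)
  have hGa : adjoint G = G := (CFC.sqrt_nonneg (B - X)).isSelfAdjoint
  have hGG : B - X = G * G := (CFC.sqrt_mul_sqrt_self _ h0).symm
  -- X vanishes on T, so against t the operator B may be replaced by B - X = G².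
  have key : ∀ z, ∀ t ∈ T, inner ℂ (B z) t = inner ℂ (G z) (G t) := by
    intro z t ht
    have h1 : inner ℂ (X z) t = 0 := by
      rw [← hX', adjoint_inner_left, apply_eq_zero_of_range_le_orthogonal hXs hXT ht,
        inner_zero_right]
    have h2 : inner ℂ ((B - X) z) t = inner ℂ (G z) (G t) := by
      rw [hGG, mul_apply_eq_comp, ← adjoint_inner_left, hGa]
    rwa [sub_apply, inner_sub_left, h1, sub_zero] at h2
  refine ⟨‖G y‖, norm_nonneg _, fun t ht => ?_⟩
  have h3 : (inner ℂ (B t) t).re = ‖G t‖ ^ 2 := by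
    rw [key t t ht]
    exact inner_self_eq_norm_sq (𝕜 := ℂ) (G t)
  rw [key y t ht, h3, Real.sqrt_sq (norm_nonneg _)]
  exact norm_inner_le_norm _ _

end Extremal

/-! ### From the decomposition of S to a sign projection, and necessity of weak complementability.
-/

section Decomposition

variable {H : Type*} [NormedAddCommGroup H] [InnerProductSpace ℂ H]

theorem inner_block_left (B : H →L[ℂ] H) (M N : Submodule ℂ H) [CompleteSpace M] (x : N) (y : M) :
    inner ℂ (block B M N x) y = inner ℂ (B x) (y : H) :=
  M.inner_orthogonalProjectionOnto_eq_of_mem_right y (B x)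

variable [CompleteSpace H]

theorem isSelfAdjoint_block {B : H →L[ℂ] H} (hB : IsSelfAdjoint B) (M : Submodule ℂ H)
    [CompleteSpace M] : IsSelfAdjoint (block B M M) := by
  have hB' : adjoint B = B := hB
  refine (eq_adjoint_iff _ _).mpr (fun x y => ?_) |>.symm
  rw [inner_block_left, ← inner_conj_symm x, inner_block_left, inner_conj_symm,
    ← adjoint_inner_left, hB']

variable {B : H →L[ℂ] H} {S Sp Sm : Submodule ℂ H} [CompleteSpace S]

/-- A sign decomposition of `S` yields the orthogonal projection of `S` onto `Sp`, whose
nullspace is `Sm`, and it is a sign projection for the compression of `B` to `S`. -/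
theorem IsSignDecomposition.exists_isSignProjection (hS : IsSignDecomposition B S Sp Sm)
    (hB : IsSelfAdjoint B) :
    ∃ p : S →L[ℂ] S, IsSignProjection (block B S S) p ∧
      (∀ s, (p s : H) ∈ Sp) ∧ (∀ s, ((s - p s : S) : H) ∈ Sm) ∧
      (∀ s : S, (s : H) ∈ Sp → p s = s) ∧ ∀ s : S, (s : H) ∈ Sm → p s = 0 := by
  set Sp' : Submodule ℂ S := Sp.comap S.subtype
  have hcl : IsClosed (Sp' : Set S) := hS.isClosed_pos.preimage continuous_subtype_val
  have : CompleteSpace Sp' := hcl.completeSpace_coe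
  set p : S →L[ℂ] S := Sp'.starProjection
  have hp : IsStarProjection p := isStarProjection_starProjection
  have hpp : ∀ s, (p s : H) ∈ Sp := fun s => Sp'.starProjection_apply_mem s
  have hpm : ∀ s : S, (s : H) ∈ Sm → p s = 0 := by
    intro s hs
    refine Sp'.starProjection_apply_eq_zero_iff.mpr ?_
    exact (Submodule.mem_orthogonal _ _).mpr fun t ht => hS.orthogonal _ ht _ hs
  have hpi : ∀ s : S, (s : H) ∈ Sp → p s = s := fun s hs =>
    Sp'.starProjection_eq_self_iff.mpr hs
  have hqm : ∀ s, ((s - p s : S) : H) ∈ Sm := by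
    intro s
    have hs : (s : H) ∈ Sp ⊔ Sm := hS.sup_eq ▸ s.2
    obtain ⟨x, hx, y, hy, hxy⟩ := Submodule.mem_sup.mp hs
    let x' : S := ⟨x, hS.sup_eq ▸ Submodule.mem_sup_left hx⟩
    let y' : S := ⟨y, hS.sup_eq ▸ Submodule.mem_sup_right hy⟩
    have hs' : s = x' + y' := Subtype.ext hxy.symm
    rw [hs', map_add, hpi x' hx, hpm y' hy, add_zero, add_sub_cancel_left]
    exact hy
  refine ⟨p, .of_inner (isSelfAdjoint_block hB S) hp (fun s t => ?_) (fun s => ?_) (fun s => ?_),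
    hpp, hqm, hpi, hpm⟩
  · rw [inner_block_left]
    exact hS.B_orthogonal _ (hpp s) _ (hqm t)
  · rw [inner_block_left]
    exact hS.nonneg _ (hpp s)
  · rw [inner_block_left]
    exact hS.nonpos _ (hqm s)

/-- The existence of the inner extrema forces weak complementability. -/
theorem IsSignDecomposition.isWeaklyComplementable (hS : IsSignDecomposition B S Sp Sm)
    (hB : IsSelfAdjoint B) {X Y : H →L[ℂ] H} (hX : X ∈ lowerSet B Spᗮ)
    (hY : Y ∈ upperSet B Smᗮ) : IsWeaklyComplementable B S := by
  obtain ⟨p, hp, hpp, hqm, hpi, hpm⟩ := hS.exists_isSignProjection hB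
  set a := block B S S
  have hQp : ∀ s, √(inner ℂ (B (p s : H)) (p s : H)).re = ‖p (modulusSqrt a s)‖ := by
    intro s
    rw [hp.norm_projection_modulusSqrt_apply, inner_block_left]
  have hQm : ∀ s, √(inner ℂ ((-B) ((s - p s : S) : H)) ((s - p s : S) : H)).re
      = ‖modulusSqrt a s - p (modulusSqrt a s)‖ := by
    intro s
    rw [hp.norm_sub_projection_modulusSqrt_apply, inner_block_left, neg_apply, inner_neg_left,
      Complex.neg_re]
  rintro _ ⟨y, rfl⟩
  obtain ⟨C, hC, h1⟩ := exists_norm_inner_le_of_mem_lowerSet hX (y : H)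
  obtain ⟨D, hD, h2⟩ := exists_norm_inner_le_of_mem_lowerSet (neg_mem_lowerSet_neg.mpr hY) (y : H)
  -- |a|^(1/2) is its own adjoint, so membership in its range follows from a bound on ⟨by, s⟩; s is
  -- split into ps and s - ps.
  rw [← adjoint_modulusSqrt]
  refine mem_range_adjoint_of_norm_inner_le _ _ (C + D) fun s => ?_
  have e : inner ℂ (block B S Sᗮ y) s
      = inner ℂ (B y) (p s : H) - inner ℂ ((-B) y) ((s - p s : S) : H) := by
    rw [inner_block_left, neg_apply, inner_neg_left, sub_neg_eq_add, ← inner_add_right]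
    simp
  calc ‖inner ℂ (block B S Sᗮ y) s‖
      ≤ ‖inner ℂ (B y) (p s : H)‖ + ‖inner ℂ ((-B) y) ((s - p s : S) : H)‖ := by
        rw [e]; exact norm_sub_le _ _
    _ ≤ C * ‖p (modulusSqrt a s)‖ + D * ‖modulusSqrt a s - p (modulusSqrt a s)‖ :=
        add_le_add (hQp s ▸ h1 _ (hpp s)) (hQm s ▸ h2 _ (hqm s))
    _ ≤ (C + D) * ‖modulusSqrt a s‖ := by
        rw [add_mul]
        exact add_le_add (mul_le_mul_of_nonneg_left (hp.norm_projection_apply_le _) hC)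
          (mul_le_mul_of_nonneg_left (hp.norm_sub_projection_apply_le _) hD)

end Decomposition

/-! ### Factorization of B through its Schur complement, and sufficiency. -/

section SchurFactorization

variable {H : Type*} [NormedAddCommGroup H] [InnerProductSpace ℂ H] [CompleteSpace H]
  {B : H →L[ℂ] H} {S Sp Sm : Submodule ℂ H} [CompleteSpace S]

theorem schurComplement_apply_of_mem (h : IsWeaklyComplementable B S) {s : H} (hs : s ∈ S) :
    schurComplement B S h s = 0 := by
  have : Sᗮ.orthogonalProjectionOnto s = 0 :=
    Submodule.orthogonalProjectionOnto_eq_zero_iff.mpr (S.le_orthogonal_orthogonal hs)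
  simp only [schurComplement, comp_apply, this, map_zero]

/-- The quadratic form of `B` in terms of its blocks relative to `S ⊕ Sᗮ`. -/
theorem inner_apply_self_eq_block (hB : IsSelfAdjoint B) (s : S) (y : Sᗮ) :
    inner ℂ (B (s + y)) ((s : H) + y) =
      inner ℂ (block B S S s) s + inner ℂ (block B S Sᗮ y) s + inner ℂ s (block B S Sᗮ y)
        + inner ℂ (block B Sᗮ Sᗮ y) y := by
  have hB' : adjoint B = B := hB
  have h1 : inner ℂ s (block B S Sᗮ y) = inner ℂ (B s) (y : H) := by
    rw [← inner_conj_symm s, inner_block_left, inner_conj_symm, ← adjoint_inner_left, hB']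
  rw [inner_block_left, inner_block_left, inner_block_left, h1, map_add, inner_add_left,
    inner_add_right, inner_add_right]
  ring

/-- If `B` is `S`-weakly complementable, then `B = B_{/S} + G* G - L* L`, where `G` vanishes on
`Sm`, `L` vanishes on `Sp`, `R(G)` lies in the closure of `G(Sp)` and `R(L)` in that of
`L(Sm)`. -/
theorem IsSignDecomposition.exists_factorization (hS : IsSignDecomposition B S Sp Sm)
    (hB : IsSelfAdjoint B) (h : IsWeaklyComplementable B S) :
    ∃ G L : H →L[ℂ] S, B = schurComplement B S h + adjoint G ∘L G - adjoint L ∘L L ∧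
      (∀ t ∈ Sm, G t = 0) ∧ (∀ t ∈ Sp, L t = 0) ∧
      (∀ z, G z ∈ closure (G '' Sp)) ∧ ∀ z, L z ∈ closure (L '' Sm) := by
  obtain ⟨p, hp, hpp, hqm, hpi, hpm⟩ := hS.exists_isSignProjection hB
  have hSpS : Sp ≤ S := hS.sup_eq ▸ le_sup_left
  have hSmS : Sm ≤ S := hS.sup_eq ▸ le_sup_right
  have hf : IsReducedSolution (modulusSqrt (block B S S)) (block B S Sᗮ)
      (reducedSolution (modulusSqrt (block B S S)) (block B S Sᗮ) h) :=
    (existsUnique_isReducedSolution _ _ h).choose_spec.1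
  have hSch : ∀ y : Sᗮ, schurComplement B S h y = ((block B Sᗮ Sᗮ y - adjoint
      (reducedSolution (modulusSqrt (block B S S)) (block B S Sᗮ) h) (polarFactor (block B S S)
        (reducedSolution (modulusSqrt (block B S S)) (block B S Sᗮ) h y)) : Sᗮ) : H) := by
    intro y
    have : Sᗮ.orthogonalProjectionOnto (y : H) = y :=
      Submodule.orthogonalProjectionOnto_mem_subspace_eq_self y
    simp only [schurComplement, comp_apply, this]
    rfl
  set a := block B S S
  set f := reducedSolution (modulusSqrt a) (block B S Sᗮ) h
  set Q := modulusSqrt a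
  have hfc : ∀ y, f y ∈ (adjoint Q).range.topologicalClosure := fun y =>
    hf.range_le (LinearMap.mem_range_self _ y)
  have hQf : ∀ y, Q (f y) = block B S Sᗮ y := fun y =>
    congrArg (fun A : Sᗮ →L[ℂ] S => A y) hf.comp_eq
  let J : S →L[ℂ] S := p - (ContinuousLinearMap.id ℂ S - p)
  let W : H →L[ℂ] S := Q ∘L S.orthogonalProjectionOnto + J ∘L f ∘L Sᗮ.orthogonalProjectionOnto
  have hWcl : ∀ z, W z ∈ (adjoint Q).range.topologicalClosure := by
    intro z
    refine Submodule.add_mem _ ?_ (hp.symmetry_apply_mem (hfc _))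
    rw [adjoint_modulusSqrt]
    exact Submodule.le_topologicalClosure _ (LinearMap.mem_range_self _ _)
  have hWS : ∀ s : S, W s = Q s := by
    intro s
    have h1 : Sᗮ.orthogonalProjectionOnto (s : H) = 0 :=
      Submodule.orthogonalProjectionOnto_eq_zero_iff.mpr (S.le_orthogonal_orthogonal s.2)
    have h2 : S.orthogonalProjectionOnto (s : H) = s :=
      Submodule.orthogonalProjectionOnto_mem_subspace_eq_self s
    simp only [W, add_apply, comp_apply, h1, h2, map_zero, add_zero]
  have hGS : ∀ s : S, (p ∘L W) s = Q (p s) := fun s => by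
    rw [comp_apply, hWS, hp.modulusSqrt_projection_apply]
  have hLS : ∀ s : S, ((ContinuousLinearMap.id ℂ S - p) ∘L W) s = Q (s - p s) := fun s => by
    rw [comp_apply, hWS, _root_.map_sub Q, hp.modulusSqrt_projection_apply]
    rfl
  refine ⟨p ∘L W, (ContinuousLinearMap.id ℂ S - p) ∘L W, ?_, ?_, ?_, ?_, ?_⟩
  -- Over ℂ an operator is determined by its quadratic form, so it suffices to compare the forms at
  -- x = s + y.
  · refine ContinuousLinearMap.coe_injective ((ext_inner_map _ _).mp fun x => ?_)
    set s := S.orthogonalProjectionOnto x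
    set y := Sᗮ.orthogonalProjectionOnto x
    have hx : x = s + y := (S.starProjection_add_starProjection_orthogonal x).symm
    have hW : W x = Q s + (p (f y) - (f y - p (f y))) := rfl
    have hid := hp.norm_sq_sub_norm_sq s (f y)
    dsimp only at hid
    rw [hQf, ← hW] at hid
    have hBx := inner_apply_self_eq_block hB s y
    rw [← hx] at hBx
    have hSx : inner ℂ (schurComplement B S h x) x
        = inner ℂ (block B Sᗮ Sᗮ y) y - inner ℂ (p (f y) - (f y - p (f y))) (f y) := by
      have h1 : schurComplement B S h x = schurComplement B S h y := by
        rw [hx, map_add, schurComplement_apply_of_mem h s.2, zero_add]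
      have h2 : ∀ v : Sᗮ, inner ℂ (v : H) x = inner ℂ v y := fun v => by
        rw [hx, inner_add_right, Submodule.inner_left_of_mem_orthogonal s.2 v.2, zero_add]
        rfl
      rw [h1, hSch, h2, inner_sub_left, adjoint_inner_left, hp.polarFactor_apply (hfc y)]
      rfl
    change inner ℂ (B x) x = inner ℂ (schurComplement B S h x
      + adjoint (p ∘L W) (p (W x))
      - adjoint ((ContinuousLinearMap.id ℂ S - p) ∘L W) (W x - p (W x))) x
    rw [inner_sub_left, inner_add_left, adjoint_inner_left, adjoint_inner_left, hSx, hBx]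
    change _ = _ + inner ℂ (p (W x)) (p (W x)) - inner ℂ (W x - p (W x)) (W x - p (W x))
    linear_combination -hid
  · intro t ht
    have := hGS ⟨t, hSmS ht⟩
    rwa [hpm ⟨t, hSmS ht⟩ ht, map_zero] at this
  · intro t ht
    have := hLS ⟨t, hSpS ht⟩
    rwa [hpi ⟨t, hSpS ht⟩ ht, sub_self, map_zero] at this
  · intro z
    refine closure_mono ?_ (hp.projection_mem_closure (hWcl z))
    rintro _ ⟨s, rfl⟩
    refine ⟨p s, hpp s, ?_⟩
    rw [hGS, hp.projection_projection_apply]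
  · intro z
    refine closure_mono ?_ (hp.sub_projection_mem_closure (hWcl z))
    rintro _ ⟨s, rfl⟩
    refine ⟨(s - p s : S), hqm s, ?_⟩
    rw [hLS, hpm _ (hqm s), sub_zero]

/-- Read off from the factorization, which avoids showing that u is selfadjoint. -/
theorem isSelfAdjoint_schurComplement (hS : IsSignDecomposition B S Sp Sm)
    (hB : IsSelfAdjoint B) (h : IsWeaklyComplementable B S) :
    IsSelfAdjoint (schurComplement B S h) := by
  obtain ⟨G, L, hGL, -⟩ := hS.exists_factorization hB h
  have : schurComplement B S h = B - adjoint G ∘L G + adjoint L ∘L L := by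
    rw [eq_sub_iff_add_eq] at hGL
    rw [← sub_eq_iff_eq_add'.mpr hGL, add_comm]
    abel
  rw [this]
  exact (hB.sub (isPositive_adjoint_comp_self G).isSelfAdjoint).add
    (isPositive_adjoint_comp_self L).isSelfAdjoint

/-- The Schur complement is the iterated minimum and the iterated maximum. -/
theorem IsSignDecomposition.isMinMax_and_isMaxMin (hS : IsSignDecomposition B S Sp Sm)
    (hB : IsSelfAdjoint B) (h : IsWeaklyComplementable B S) :
    IsMinMax B Sp Sm (schurComplement B S h) ∧ IsMaxMin B Sp Sm (schurComplement B S h) := by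
  have hC := isSelfAdjoint_schurComplement hS hB h
  have hC0 : ∀ t ∈ S, schurComplement B S h t = 0 := fun t => schurComplement_apply_of_mem h
  have hSpS : Sp ≤ S := hS.sup_eq ▸ le_sup_left
  have hSmS : Sm ≤ S := hS.sup_eq ▸ le_sup_right
  obtain ⟨G, L, hGL, hG0, hL0, hG, hL⟩ := hS.exists_factorization hB h
  set C := schurComplement B S h
  have hGa := (isPositive_adjoint_comp_self G).isSelfAdjoint
  have hLa := (isPositive_adjoint_comp_self L).isSelfAdjoint
  -- The inner extremum removes one of the two squares from B = C + G*G - L*L, and the outer one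
  -- removes the other.
  refine ⟨⟨C - adjoint L ∘L L, isGreatest_lowerSet (G := G) (hC.sub hLa) ?_ ?_ hG,
    isLeast_upperSet (G := L) hC (fun t ht => hC0 t (hSmS ht)) ?_ hL⟩,
    ⟨C + adjoint G ∘L G, isLeast_upperSet (G := L) (hC.add hGa) ?_ ?_ hL,
    isGreatest_lowerSet (G := G) hC (fun t ht => hC0 t (hSpS ht)) rfl hG⟩⟩
  · intro t ht
    rw [sub_apply, comp_apply, hL0 t ht, hC0 t (hSpS ht), map_zero, sub_zero]
  · rw [hGL]
    abel
  · abel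
  · intro t ht
    rw [add_apply, comp_apply, hG0 t ht, hC0 t (hSmS ht), map_zero, add_zero]
  · rw [hGL]
    abel

end SchurFactorization

end SchurMinMax

theorem theorem3p5 {H : Type*} [NormedAddCommGroup H] [InnerProductSpace ℂ H] [CompleteSpace H]
    (B : H →L[ℂ] H) (hB : IsSelfAdjoint B)
    (S Sp Sm : Submodule ℂ H) [CompleteSpace S]
    (hS : SchurMinMax.IsSignDecomposition B S Sp Sm) :
    (SchurMinMax.IsWeaklyComplementable B S ↔
      (∃ Y, SchurMinMax.IsMinMax B Sp Sm Y) ∧ (∃ Y, SchurMinMax.IsMaxMin B Sp Sm Y)) ∧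
    ∀ h : SchurMinMax.IsWeaklyComplementable B S,
      SchurMinMax.IsMinMax B Sp Sm (SchurMinMax.schurComplement B S h) ∧
      SchurMinMax.IsMaxMin B Sp Sm (SchurMinMax.schurComplement B S h) := by
  refine ⟨⟨fun h => ?_, ?_⟩, fun h => hS.isMinMax_and_isMaxMin hB h⟩
  · exact ⟨⟨_, (hS.isMinMax_and_isMaxMin hB h).1⟩, ⟨_, (hS.isMinMax_and_isMaxMin hB h).2⟩⟩
  -- Only membership of the inner extrema in their sets is needed; the outer extrema play no role.
  · rintro ⟨⟨_, X, hX, -⟩, ⟨_, Y, hY, -⟩⟩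
    exact hS.isWeaklyComplementable hB hX.1 hY.1
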